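/- For $c>0$ call a function $F:[1,\infty)\to\mathbb{R}$ \emph{admissible for $c$} if for every real $x\ge 1$ the interval $[x-F(x),\,x+F(x)]$ contains an integer $n=ab$ with $a,b$ integers in $[0,c\sqrt{x}]$. (i) (Lower bound.) For every $c>0$ there is a constant $C=C(c)>0$ such that every $F$ admissible for $c$ has the following property: for every $x\ge 2$ there is $y\in[x,2x]$ with $F(y)\ge C(\log x)^{0.086}$. If $F$ is moreover non-decreasing, then $F(x)\ge C(\log x)^{0.086}$ for all $x\ge 2$. (ii) (Upper bound.) For every $c>1$ there is a constant $C=C(c)>0$ such that $x\mapsto Cx^{1/4}$ is admissible for $c$. (iii) Consequently, for every $c>1$ there is a (pointwise) least non-decreasing function $F$ on $[1,\infty)$ that is admissible for $c$, and it satisfies, for all $x\ge 2$, $$(\log x)^{0.086}\ll_c F(x)\ll_c x^{1/4}.$$ -/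

import Mathlib

/-- `F` is an admissible radius for the constant `c`: for every real `x ≥ 1` the interval
`[x - F x, x + F x]` contains an integer `n = a * b` with integers `a`, `b` in `[0, c * √x]`.
(Non-negativity of `F` on `[1, ∞)` is a consequence.) -/
def AdmissibleRadius (c : ℝ) (F : ℝ → ℝ) : Prop :=
  ∀ x : ℝ, 1 ≤ x → ∃ n a b : ℤ, n = a * b ∧
    (a : ℝ) ∈ Set.Icc 0 (c * Real.sqrt x) ∧
    (b : ℝ) ∈ Set.Icc 0 (c * Real.sqrt x) ∧
    (n : ℝ) ∈ Set.Icc (x - F x) (x + F x)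

/-- `F` is, on `[1, ∞)`, the least non-decreasing admissible radius for the constant `c`. -/
def IsLeastMonotoneRadius (c : ℝ) (F : ℝ → ℝ) : Prop :=
  AdmissibleRadius c F ∧ MonotoneOn F (Set.Ici 1) ∧
    ∀ G : ℝ → ℝ, AdmissibleRadius c G → MonotoneOn G (Set.Ici 1) →
      ∀ x : ℝ, 1 ≤ x → F x ≤ G x

section

open Finset ArithmeticFunction
open scoped ArithmeticFunction.Omega

/-! Lower bound: if `F < H` on `[x, 2x]`, intervals of length `2H` around `0` and the entries of an
`N × N` multiplication table, `N ≍ √x`, cover `[x, 2x]`, so `x ≪ H · card`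
(`AdmissibleRadius.le_mul_card`). Erdős's theorem `exists_card_table_le` makes the table smaller
than `N ^ 2` by a power of `log N`: a typical integer up to `N ^ 2` has about `log log N` prime
factors, a typical product `a * b` about twice that. The quantitative input is the mean value of `y
^ Ω(n)`, `exists_sum_pow_cardFactors_le`.

Upper bound: approximate `x` by a difference of squares `u ^ 2 - v ^ 2 = (u - v) * (u + v)` with `u
= ⌈√x⌉`. The least radius is the running supremum of the distance to the nearest allowed product. -/

/-! ### Euler products and the logarithmic mean of `y ^ Ω(n)`. -/

theorem tsum_rpow_neg_le {s : ℝ} (hs : 1 < s) :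
    ∑' n : ℕ, (n : ℝ) ^ (-s) ≤ 1 + 1 / (s - 1) := by
  have hsum : Summable fun n : ℕ => (n : ℝ) ^ (-s) := Real.summable_nat_rpow.2 (by linarith)
  have h := ZetaAsymptotics.zeta_limit_aux1 hs
  have hT : 0 ≤ ZetaAsymptotics.termTSum s := tsum_nonneg fun n => ZetaAsymptotics.term_nonneg _ _
  have h0 : ∑' n : ℕ, (n : ℝ) ^ (-s) = ∑' n : ℕ, 1 / (n + 1 : ℝ) ^ s := by
    rw [hsum.tsum_eq_zero_add]
    simp only [Nat.cast_zero, Real.zero_rpow (by linarith : -s ≠ 0), zero_add]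
    refine tsum_congr fun n => ?_
    rw [Real.rpow_neg (by positivity), one_div]
    push_cast
    rfl
  have : 0 ≤ s * ZetaAsymptotics.termTSum s := by positivity
  rw [h0]
  linarith

/-- With `t = p ^ (-s)`, this compares the Euler factors of `∑ y ^ Ω(n) n ^ (-s)` and `ζ(s) ^ y`.
They agree to first order in `t`, and the errors `t ^ 2` are summable over primes; `y < 2` keeps `1
- y * t` away from `0`. -/
theorem exists_euler_factor_le {y : ℝ} (hy0 : 0 < y) (hy2 : y < 2) :
    ∃ C : ℝ, 0 ≤ C ∧ ∀ t : ℝ, 0 ≤ t → t ≤ 1 / 2 →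
      (1 - y * t)⁻¹ ≤ ((1 - t)⁻¹) ^ y * Real.exp (C * t ^ 2) := by
  have key : ∃ C : ℝ, 0 ≤ C ∧ ∀ t : ℝ, 0 ≤ t → t ≤ 1 / 2 →
      (1 - t) ^ y ≤ (1 - y * t) * (1 + C * t ^ 2) := by
    rcases le_total y 1 with h1 | h1
    · refine ⟨0, le_rfl, fun t ht0 ht => ?_⟩
      have := rpow_one_add_le_one_add_mul_self (s := -t) (by linarith) hy0.le h1
      rw [← sub_eq_add_neg] at this
      linarith
    -- Bernoulli for concave powers needs an exponent at most `1`, so one factor `1 - t` is split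
    -- off; the excess is `(y - 1) * t ^ 2`.
    · have hd : 0 < 1 - y / 2 := by linarith
      refine ⟨(y - 1) / (1 - y / 2), div_nonneg (by linarith) hd.le, fun t ht0 ht => ?_⟩
      have h := rpow_one_add_le_one_add_mul_self (s := -t) (p := y - 1) (by linarith)
        (by linarith) (by linarith)
      rw [← sub_eq_add_neg] at h
      have h2 : (1 - t) ^ y = (1 - t) * (1 - t) ^ (y - 1) := by
        rw [← Real.rpow_one_add' (by linarith) (by linarith)]
        congr 1
        ring
      have h3 : (1 - t) * (1 - t) ^ (y - 1) ≤ (1 - t) * (1 + (y - 1) * -t) :=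
        mul_le_mul_of_nonneg_left h (by linarith)
      have h4 : y - 1 ≤ (1 - y * t) * ((y - 1) / (1 - y / 2)) := by
        rw [mul_div_assoc', le_div_iff₀ hd, mul_comm]
        have : y * t ≤ y / 2 := by nlinarith
        exact mul_le_mul_of_nonneg_right (by linarith) (by linarith)
      have h5 := mul_le_mul_of_nonneg_right h4 (sq_nonneg t)
      rw [h2]
      nlinarith
  obtain ⟨C, hC, h⟩ := key
  refine ⟨C, hC, fun t ht0 ht => ?_⟩
  have hp : 0 < 1 - y * t := by nlinarith
  have hq : 0 < 1 - t := by linarith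
  rw [Real.inv_rpow hq.le, ← div_eq_inv_mul, le_div_iff₀ (Real.rpow_pos_of_pos hq _),
    ← div_eq_inv_mul, div_le_iff₀ hp]
  calc (1 - t) ^ y ≤ (1 - y * t) * (1 + C * t ^ 2) := h t ht0 ht
    _ ≤ (1 - y * t) * Real.exp (C * t ^ 2) := by
      gcongr
      linarith [Real.add_one_le_exp (C * t ^ 2)]
    _ = _ := mul_comm _ _

/-- The completely multiplicative function `n ↦ y ^ Ω(n) * n ^ (-s)`. -/
noncomputable def omegaDirichletHom (y s : ℝ) (hs : s ≠ 0) : ℕ →* ℝ where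
  toFun n := y ^ Ω n * (n : ℝ) ^ (-s)
  map_one' := by simp
  map_mul' m n := by
    rcases eq_or_ne m 0 with rfl | hm
    · simp [Real.zero_rpow (neg_ne_zero.2 hs)]
    rcases eq_or_ne n 0 with rfl | hn
    · simp [Real.zero_rpow (neg_ne_zero.2 hs)]
    rw [cardFactors_mul hm hn, pow_add, Nat.cast_mul,
      Real.mul_rpow (Nat.cast_nonneg _) (Nat.cast_nonneg _)]
    ring

theorem omegaDirichletHom_apply (y s : ℝ) (hs : s ≠ 0) (n : ℕ) :
    omegaDirichletHom y s hs n = y ^ Ω n * (n : ℝ) ^ (-s) := rfl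

theorem Nat.Prime.rpow_neg_le_inv {p : ℕ} (hp : p.Prime) {s : ℝ} (hs : 1 ≤ s) :
    (p : ℝ) ^ (-s) ≤ (p : ℝ)⁻¹ := by
  rw [← Real.rpow_neg_one]
  exact Real.rpow_le_rpow_of_exponent_le (by exact_mod_cast hp.one_le) (by linarith)

theorem Nat.Prime.rpow_neg_le_half {p : ℕ} (hp : p.Prime) {s : ℝ} (hs : 1 ≤ s) :
    (p : ℝ) ^ (-s) ≤ 1 / 2 := by
  refine (hp.rpow_neg_le_inv hs).trans ?_
  rw [one_div]
  exact inv_anti₀ two_pos (by exact_mod_cast hp.two_le)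

theorem sum_le_prod_primesBelow {f : ℕ →* ℝ} (h0 : ∀ n, 0 ≤ f n)
    (h1 : ∀ {p : ℕ}, p.Prime → ‖f p‖ < 1) (N : ℕ) :
    ∑ m ∈ Ioc 0 N, f m ≤ ∏ p ∈ (N + 1).primesBelow, (1 - f p)⁻¹ := by
  have h := (EulerProduct.summable_and_hasSum_smoothNumbers_prod_primesBelow_geometric
    h1 (N + 1)).2
  have hm : ∀ m ∈ Ioc 0 N, m ∈ (N + 1).smoothNumbers := fun m hm => by
    rw [mem_Ioc] at hm
    exact Nat.mem_smoothNumbers_of_lt hm.1 (by omega)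
  have := sum_le_hasSum ((Ioc 0 N).subtype (· ∈ (N + 1).smoothNumbers))
    (fun m _ => h0 m) h
  rwa [Finset.sum_subtype_of_mem (fun m => f m) hm] at this

theorem prod_primesBelow_inv_one_sub_le {s : ℝ} (hs : 1 < s) (N : ℕ) :
    ∏ p ∈ N.primesBelow, (1 - (p : ℝ) ^ (-s))⁻¹ ≤ 1 + 1 / (s - 1) := by
  have hs0 : s ≠ 0 := by linarith
  have hsum : Summable fun n : ℕ => (n : ℝ) ^ (-s) := Real.summable_nat_rpow.2 (by linarith)
  have h := (EulerProduct.summable_and_hasSum_smoothNumbers_prod_primesBelow_geometric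
    (f := omegaDirichletHom 1 s hs0) (fun {p} hp => by
      rw [omegaDirichletHom_apply, one_pow, one_mul, Real.norm_of_nonneg (by positivity)]
      linarith [hp.rpow_neg_le_half hs.le]) N).2
  simp only [omegaDirichletHom_apply, one_pow, one_mul] at h
  rw [← h.tsum_eq]
  refine le_trans ?_ (tsum_rpow_neg_le hs)
  exact hsum.tsum_subtype_le (f := fun n : ℕ => (n : ℝ) ^ (-s)) _ (fun n => by positivity)

/-- Rankin's trick: at `s = 1 + 1 / log N` one has `1 / m ≤ e * m ^ (-s)` for `m ≤ N`, and the Euler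
product is `O(ζ(s) ^ y)` with `ζ(s) ≤ 1 + log N`. -/
theorem exists_sum_pow_cardFactors_div_le {y : ℝ} (hy0 : 0 < y) (hy2 : y < 2) :
    ∃ B : ℝ, 0 < B ∧ ∀ N : ℕ, 2 ≤ N →
      ∑ m ∈ Ioc 0 N, y ^ Ω m / m ≤ B * Real.log N ^ y := by
  obtain ⟨C, hC, hCt⟩ := exists_euler_factor_le hy0 hy2
  set Z : ℝ := ∑' n : ℕ, (n : ℝ) ^ (-2 : ℝ)
  have hZs : Summable fun n : ℕ => (n : ℝ) ^ (-2 : ℝ) := Real.summable_nat_rpow.2 (by norm_num)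
  have hl2 : 0 < Real.log 2 := Real.log_pos (by norm_num)
  refine ⟨Real.exp 1 * (Real.exp (C * Z) * (1 / Real.log 2 + 1) ^ y), by positivity,
    fun N hN => ?_⟩
  have hN' : (2 : ℝ) ≤ N := by exact_mod_cast hN
  have hlN2 : Real.log 2 ≤ Real.log N := Real.log_le_log two_pos hN'
  have hlN : 0 < Real.log N := hl2.trans_le hlN2
  set s : ℝ := 1 + 1 / Real.log N with hsdef
  have hs : 1 < s := by
    rw [hsdef]
    have : 0 < 1 / Real.log N := by positivity
    linarith
  have hs0 : s ≠ 0 := by linarith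
  have step1 : ∑ m ∈ Ioc 0 N, y ^ Ω m / m ≤
      Real.exp 1 * ∑ m ∈ Ioc 0 N, omegaDirichletHom y s hs0 m := by
    rw [mul_sum]
    refine sum_le_sum fun m hm => ?_
    rw [mem_Ioc] at hm
    have hm0 : (0 : ℝ) < m := by exact_mod_cast hm.1
    have hmN : (m : ℝ) ≤ N := by exact_mod_cast hm.2
    have : (m : ℝ)⁻¹ ≤ Real.exp 1 * (m : ℝ) ^ (-s) := by
      rw [Real.rpow_def_of_pos hm0, ← Real.exp_add, ← Real.exp_log hm0, ← Real.exp_neg,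
        Real.exp_log hm0]
      refine Real.exp_le_exp.2 ?_
      have h1 : Real.log m ≤ Real.log N := Real.log_le_log hm0 hmN
      have h2 : Real.log m / Real.log N ≤ 1 := (div_le_one hlN).2 h1
      rw [hsdef]
      have : Real.log m * -(1 + 1 / Real.log N) = - Real.log m - Real.log m / Real.log N := by ring
      linarith
    rw [omegaDirichletHom_apply, div_eq_mul_inv, mul_left_comm]
    exact mul_le_mul_of_nonneg_left this (by positivity)
  have step2 : ∑ m ∈ Ioc 0 N, omegaDirichletHom y s hs0 m ≤
      ∏ p ∈ (N + 1).primesBelow, (1 - y * (p : ℝ) ^ (-s))⁻¹ := by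
    refine (sum_le_prod_primesBelow (fun n => ?_) (fun {p} hp => ?_) N).trans_eq ?_
    · rw [omegaDirichletHom_apply]; positivity
    · rw [omegaDirichletHom_apply, cardFactors_apply_prime hp, pow_one,
        Real.norm_of_nonneg (by positivity)]
      nlinarith [hp.rpow_neg_le_half hs.le]
    · refine prod_congr rfl fun p hp => ?_
      rw [omegaDirichletHom_apply, cardFactors_apply_prime (Nat.prime_of_mem_primesBelow hp),
        pow_one]
  have step3 : ∏ p ∈ (N + 1).primesBelow, (1 - y * (p : ℝ) ^ (-s))⁻¹ ≤
      Real.exp (C * Z) * (1 / Real.log 2 + 1) ^ y * Real.log N ^ y := by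
    calc ∏ p ∈ (N + 1).primesBelow, (1 - y * (p : ℝ) ^ (-s))⁻¹
        ≤ ∏ p ∈ (N + 1).primesBelow,
            (((1 - (p : ℝ) ^ (-s))⁻¹) ^ y * Real.exp (C * (p : ℝ) ^ (-2 : ℝ))) := by
          refine prod_le_prod (fun p hp => ?_) (fun p hp => ?_)
          · have := (Nat.prime_of_mem_primesBelow hp).rpow_neg_le_half hs.le
            rw [inv_nonneg]
            nlinarith
          · have hp' := Nat.prime_of_mem_primesBelow hp
            refine (hCt _ (by positivity) (hp'.rpow_neg_le_half hs.le)).trans ?_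
            have h1 := hp'.rpow_neg_le_half hs.le
            have : 0 ≤ ((1 - (p : ℝ) ^ (-s))⁻¹) ^ y := by
              apply Real.rpow_nonneg
              rw [inv_nonneg]
              linarith
            gcongr
            have := pow_le_pow_left₀ (by positivity) (hp'.rpow_neg_le_inv hs.le) 2
            refine this.trans_eq ?_
            rw [Real.rpow_neg (by positivity), inv_pow]
            norm_cast
      _ = (∏ p ∈ (N + 1).primesBelow, (1 - (p : ℝ) ^ (-s))⁻¹) ^ y *
            Real.exp (C * ∑ p ∈ (N + 1).primesBelow, (p : ℝ) ^ (-2 : ℝ)) := by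
          rw [prod_mul_distrib, ← Real.exp_sum, mul_sum, Real.finsetProd_rpow]
          intro p hp
          have := (Nat.prime_of_mem_primesBelow hp).rpow_neg_le_half hs.le
          rw [inv_nonneg]
          linarith
      _ ≤ ((1 / Real.log 2 + 1) * Real.log N) ^ y * Real.exp (C * Z) := by
          have h1 : 0 ≤ ∏ p ∈ (N + 1).primesBelow, (1 - (p : ℝ) ^ (-s))⁻¹ := by
            refine prod_nonneg fun p hp => ?_
            have := (Nat.prime_of_mem_primesBelow hp).rpow_neg_le_half hs.le
            rw [inv_nonneg]
            linarith
          have h2 := prod_primesBelow_inv_one_sub_le hs (N + 1)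
          have h3 : 1 + 1 / (s - 1) ≤ (1 / Real.log 2 + 1) * Real.log N := by
            have : 1 / (s - 1) = Real.log N := by rw [hsdef]; simp
            rw [this, add_mul, one_mul, one_div, ← div_eq_inv_mul]
            have : 1 ≤ Real.log N / Real.log 2 := (one_le_div hl2).2 hlN2
            linarith
          have h4 : ∑ p ∈ (N + 1).primesBelow, (p : ℝ) ^ (-2 : ℝ) ≤ Z :=
            hZs.sum_le_tsum _ (fun n _ => by positivity)
          gcongr
          exact h2.trans h3
      _ = _ := by
          rw [Real.mul_rpow (by positivity) hlN.le]
          ring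
  calc _ ≤ _ := step1
    _ ≤ Real.exp 1 * (Real.exp (C * Z) * (1 / Real.log 2 + 1) ^ y * Real.log N ^ y) := by
      gcongr
      exact step2.trans step3
    _ = _ := by ring

/-! ### From the logarithmic mean to the mean value of `y ^ Ω(n)`. -/

/-- Controls the proper prime powers in the weighted Chebyshev bound below: since `y < 2 ≤ p`, the
geometric series are `O(p ^ (-2))`, and `log p = O(p ^ (1 / 2))`. -/
theorem sum_primes_log_mul_sum_pow_le {y : ℝ} (hy0 : 0 < y) (hy2 : y < 2) :
    ∃ A : ℝ, 0 ≤ A ∧ ∀ D K : ℕ,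
      ∑ p ∈ Ioc 0 D with p.Prime, Real.log p * ∑ k ∈ Icc 2 K, (y / p) ^ k ≤ A := by
  set Z : ℝ := ∑' n : ℕ, (n : ℝ) ^ (-(3 / 2) : ℝ)
  have hZs : Summable fun n : ℕ => (n : ℝ) ^ (-(3 / 2) : ℝ) :=
    Real.summable_nat_rpow.2 (by norm_num)
  have hd : 0 < 1 - y / 2 := by linarith
  have hZ : 0 ≤ Z := tsum_nonneg fun n => by positivity
  refine ⟨2 * (y ^ 2 / (1 - y / 2)) * Z, by positivity, fun D K => ?_⟩
  calc ∑ p ∈ Ioc 0 D with p.Prime, Real.log p * ∑ k ∈ Icc 2 K, (y / p) ^ k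
      ≤ ∑ p ∈ Ioc 0 D with p.Prime, 2 * (y ^ 2 / (1 - y / 2)) * (p : ℝ) ^ (-(3 / 2) : ℝ) := by
        refine sum_le_sum fun p hp => ?_
        have hp' : p.Prime := (mem_filter.1 hp).2
        have hp2 : (2 : ℝ) ≤ p := by exact_mod_cast hp'.two_le
        have hp0 : (0 : ℝ) < p := by linarith
        have hlog : Real.log p ≤ 2 * (p : ℝ) ^ (1 / 2 : ℝ) := by
          have := Real.log_le_rpow_div hp0.le (ε := 1 / 2) (by norm_num)
          linarith
        have hr1 : y / p ≤ y / 2 := div_le_div_of_nonneg_left hy0.le two_pos hp2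
        have hr0 : 0 ≤ y / p := by positivity
        have hgeom : ∑ k ∈ Icc 2 K, (y / p) ^ k ≤ (y / p) ^ 2 / (1 - y / 2) := by
          have h1 : ∑ k ∈ Icc 2 K, (y / p) ^ k ≤ ∑ k ∈ Ico 2 (K + 1), (y / p) ^ k :=
            le_of_eq (by congr 1)
          refine h1.trans ((geom_sum_Ico_le_of_lt_one hr0 (by linarith)).trans ?_)
          gcongr
        calc Real.log p * ∑ k ∈ Icc 2 K, (y / p) ^ k
            ≤ (2 * (p : ℝ) ^ (1 / 2 : ℝ)) * ((y / p) ^ 2 / (1 - y / 2)) := by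
              have : 0 ≤ ∑ k ∈ Icc 2 K, (y / p) ^ k := sum_nonneg fun k _ => by positivity
              gcongr
          _ = 2 * (y ^ 2 / (1 - y / 2)) * ((p : ℝ) ^ (1 / 2 : ℝ) * (p : ℝ) ^ (-2 : ℝ)) := by
              have : (p : ℝ) ^ (-2 : ℝ) = ((p : ℝ) ^ 2)⁻¹ := by
                rw [Real.rpow_neg hp0.le]
                norm_cast
              rw [this, div_pow]
              ring
          _ = _ := by
              rw [← Real.rpow_add hp0]
              norm_num
    _ = 2 * (y ^ 2 / (1 - y / 2)) * ∑ p ∈ Ioc 0 D with p.Prime, (p : ℝ) ^ (-(3 / 2) : ℝ) := by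
        rw [mul_sum]
    _ ≤ _ := by
        gcongr
        exact hZs.sum_le_tsum _ (fun n _ => by positivity)

theorem exists_sum_vonMangoldt_mul_pow_cardFactors_le {y : ℝ} (hy0 : 0 < y) (hy2 : y < 2) :
    ∃ A : ℝ, 0 ≤ A ∧ ∀ D : ℕ, ∑ d ∈ Ioc 0 D, Λ d * y ^ Ω d ≤ A * D := by
  obtain ⟨A, hA0, hA⟩ := sum_primes_log_mul_sum_pow_le hy0 hy2
  have hl4 : 0 ≤ Real.log 4 := Real.log_nonneg (by norm_num)
  refine ⟨y * Real.log 4 + A, by positivity, fun D => ?_⟩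
  set K := ⌊Real.log D / Real.log 2⌋₊ + 1 with hK
  have e1 : ∑ d ∈ Ioc 0 D, Λ d * y ^ Ω d =
      ∑ d ∈ Ioc 0 ⌊(D : ℝ)⌋₊ with IsPrimePow d, Λ d * y ^ Ω d := by
    rw [Nat.floor_natCast, sum_filter_of_ne]
    intro d _ hd
    exact vonMangoldt_ne_zero_iff.1 (left_ne_zero_of_mul hd)
  rw [e1, Chebyshev.sum_PrimePow_eq_sum_sum' _ (Nat.cast_nonneg D) (Nat.le_succ _)]
  have e2 : Icc 1 K = insert 1 (Icc 2 K) := by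
    rw [← Finset.insert_Icc_succ_left_eq_Icc (by omega)]
    rfl
  rw [← Nat.succ_eq_add_one] at hK
  rw [← hK, e2, sum_insert (by simp)]
  have first : ∑ p ∈ Ioc 0 ⌊(D : ℝ) ^ ((1 : ℝ) / (1 : ℕ))⌋₊ with p.Prime,
      Λ (p ^ 1) * y ^ Ω (p ^ 1) ≤ y * Real.log 4 * D := by
    have := Chebyshev.theta_le_log4_mul_x (x := D) (Nat.cast_nonneg D)
    rw [Nat.cast_one, div_one, Real.rpow_one]
    calc _ = y * Chebyshev.theta D := by
          rw [Chebyshev.theta, mul_sum]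
          refine sum_congr rfl fun p hp => ?_
          have hp' : p.Prime := (mem_filter.1 hp).2
          rw [pow_one, vonMangoldt_apply_prime hp', cardFactors_apply_prime hp', pow_one, mul_comm]
      _ ≤ _ := by rw [mul_assoc]; gcongr
  have rest : ∑ k ∈ Icc 2 K, ∑ p ∈ Ioc 0 ⌊(D : ℝ) ^ ((1 : ℝ) / k)⌋₊ with p.Prime,
      Λ (p ^ k) * y ^ Ω (p ^ k) ≤ A * D := by
    -- Here `p ^ k ≤ D`, hence `y ^ k ≤ D * (y / p) ^ k`.
    calc _ ≤ ∑ k ∈ Icc 2 K, ∑ p ∈ Ioc 0 D with p.Prime, D * (Real.log p * (y / p) ^ k) := by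
          refine sum_le_sum fun k hk => ?_
          have hk2 : 2 ≤ k := (mem_Icc.1 hk).1
          have hk0 : (0 : ℝ) < k := by exact_mod_cast (by omega : 0 < k)
          rcases Nat.eq_zero_or_pos D with rfl | hD
          · have : (1 : ℝ) / k ≠ 0 := by positivity
            rw [Nat.cast_zero, Real.zero_rpow this]
            simp
          have hD1 : (1 : ℝ) ≤ D := by exact_mod_cast hD
          have hsub : ⌊(D : ℝ) ^ ((1 : ℝ) / k)⌋₊ ≤ D := by
            refine Nat.floor_le_of_le ?_
            refine (Real.rpow_le_rpow_of_exponent_le hD1 ?_).trans_eq (Real.rpow_one _)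
            rw [div_le_one hk0]
            exact_mod_cast (by omega : 1 ≤ k)
          refine le_trans (sum_le_sum fun p hp => ?_)
            (sum_le_sum_of_subset_of_nonneg (filter_subset_filter _ (Ioc_subset_Ioc_right hsub))
              fun p _ _ => ?_)
          · rw [mem_filter, mem_Ioc] at hp
            have hp0 : (0 : ℝ) < p := by exact_mod_cast hp.1.1
            have hpk : (p : ℝ) ^ k ≤ D := by
              have h1 : (p : ℝ) ≤ (D : ℝ) ^ ((1 : ℝ) / k) :=
                (Nat.le_floor_iff (by positivity)).1 hp.1.2
              have h2 := pow_le_pow_left₀ hp0.le h1 k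
              rwa [one_div, Real.rpow_inv_natCast_pow (Nat.cast_nonneg D) (by omega)] at h2
            rw [vonMangoldt_apply_pow (by omega), vonMangoldt_apply_prime hp.2,
              cardFactors_apply_prime_pow hp.2]
            have hlog : 0 ≤ Real.log p := Real.log_natCast_nonneg p
            rw [mul_left_comm]
            refine mul_le_mul_of_nonneg_left ?_ hlog
            rw [div_pow, mul_div_assoc', le_div_iff₀ (by positivity), mul_comm]
            gcongr
          · have hlog : 0 ≤ Real.log p := Real.log_natCast_nonneg p
            positivity
      _ = D * ∑ p ∈ Ioc 0 D with p.Prime, Real.log p * ∑ k ∈ Icc 2 K, (y / p) ^ k := by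
          rw [sum_comm, mul_sum]
          simp_rw [mul_sum]
      _ ≤ A * D := by
          rw [mul_comm A]
          gcongr
          exact hA D K
  linarith

/-- The arithmetic function `n ↦ y ^ Ω(n)`, extended by zero at `n = 0`. -/
noncomputable def powCardFactors (y : ℝ) : ArithmeticFunction ℝ :=
  ⟨fun n => if n = 0 then 0 else y ^ Ω n, by simp⟩

theorem powCardFactors_apply (y : ℝ) {n : ℕ} (hn : n ≠ 0) : powCardFactors y n = y ^ Ω n := by
  simp [powCardFactors, hn]

/-- The identity `Λ * 1 = log`, twisted by the completely multiplicative `y ^ Ω`. -/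
theorem pmul_vonMangoldt_mul_powCardFactors (y : ℝ) :
    pmul Λ (powCardFactors y) * powCardFactors y = pmul log (powCardFactors y) := by
  ext n
  rcases eq_or_ne n 0 with rfl | hn
  · simp
  rw [mul_apply, pmul_apply, log_apply, ← vonMangoldt_sum, sum_mul,
    ← Nat.sum_divisorsAntidiagonal fun i _ => Λ i * powCardFactors y n]
  refine sum_congr rfl fun x hx => ?_
  obtain ⟨hx1, -⟩ := Nat.mem_divisorsAntidiagonal.1 hx
  have h1 : x.1 ≠ 0 := by rintro h; simp [h] at hx1; exact hn hx1.symm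
  have h2 : x.2 ≠ 0 := by rintro h; simp [h] at hx1; exact hn hx1.symm
  rw [pmul_apply, powCardFactors_apply y h1, powCardFactors_apply y h2,
    powCardFactors_apply y hn, ← hx1, cardFactors_mul h1 h2, pow_add]
  ring

theorem sum_pow_cardFactors_mul_log (y : ℝ) (N : ℕ) :
    ∑ n ∈ Ioc 0 N, y ^ Ω n * Real.log n =
      ∑ m ∈ Ioc 0 N, y ^ Ω m * ∑ d ∈ Ioc 0 (N / m), Λ d * y ^ Ω d := by
  have h := sum_Ioc_mul_eq_sum_sum (powCardFactors y) (pmul Λ (powCardFactors y)) N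
  rw [mul_comm, pmul_vonMangoldt_mul_powCardFactors] at h
  have hne {n M : ℕ} (hn : n ∈ Ioc 0 M) : n ≠ 0 := (mem_Ioc.1 hn).1.ne'
  calc _ = ∑ n ∈ Ioc 0 N, (pmul log (powCardFactors y)) n := sum_congr rfl fun n hn => by
        rw [pmul_apply, log_apply, powCardFactors_apply y (hne hn), mul_comm]
    _ = _ := h
    _ = _ := sum_congr rfl fun n hn => by
        rw [powCardFactors_apply y (hne hn)]
        congr 1
        exact sum_congr rfl fun d hd => by
          rw [pmul_apply, powCardFactors_apply y (hne hd)]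

/-- The mean value of `y ^ Ω(n)` over `n ≤ N` is `O((log N) ^ (y - 1))`, for `0 < y < 2`. -/
theorem exists_sum_pow_cardFactors_le {y : ℝ} (hy0 : 0 < y) (hy2 : y < 2) :
    ∃ A : ℝ, 0 < A ∧ ∀ N : ℕ, 2 ≤ N →
      ∑ n ∈ Ioc 0 N, y ^ Ω n ≤ A * N * Real.log N ^ (y - 1) := by
  obtain ⟨B, hB0, hB⟩ := exists_sum_pow_cardFactors_div_le hy0 hy2
  obtain ⟨A, hA0, hA⟩ := exists_sum_vonMangoldt_mul_pow_cardFactors_le hy0 hy2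
  refine ⟨(A + 1) * B, by positivity, fun N hN => ?_⟩
  have hlN : 0 < Real.log N := Real.log_pos (by exact_mod_cast (by omega : 1 < N))
  have hN0 : (0 : ℝ) < N := by exact_mod_cast (by omega : 0 < N)
  set S := ∑ m ∈ Ioc 0 N, y ^ Ω m / m with hS
  -- Split `log N = log n + log (N / n)`: the first part is a convolution with `Λ`, the second uses
  -- `log u ≤ u`. Dividing by `log N` at the end saves one power.
  have h1 : ∑ n ∈ Ioc 0 N, y ^ Ω n * Real.log n ≤ A * N * S := by
    rw [sum_pow_cardFactors_mul_log, hS, mul_sum]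
    refine sum_le_sum fun m hm => ?_
    calc y ^ Ω m * ∑ d ∈ Ioc 0 (N / m), Λ d * y ^ Ω d ≤ y ^ Ω m * (A * (N / m)) := by
          gcongr
          refine (hA _).trans ?_
          gcongr
          exact Nat.cast_div_le
      _ = _ := by ring
  have h2 : ∑ n ∈ Ioc 0 N, y ^ Ω n * (Real.log N - Real.log n) ≤ N * S := by
    rw [hS, mul_sum]
    refine sum_le_sum fun m hm => ?_
    have hm0 : (0 : ℝ) < m := by exact_mod_cast (mem_Ioc.1 hm).1
    rw [← Real.log_div hN0.ne' hm0.ne']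
    calc y ^ Ω m * Real.log (N / m) ≤ y ^ Ω m * (N / m) := by
          gcongr
          exact (Real.log_le_sub_one_of_pos (by positivity)).trans (by linarith)
      _ = _ := by ring
  have h3 : (∑ n ∈ Ioc 0 N, y ^ Ω n) * Real.log N ≤ (A + 1) * N * S := by
    have : (∑ n ∈ Ioc 0 N, y ^ Ω n) * Real.log N = ∑ n ∈ Ioc 0 N, y ^ Ω n * Real.log n +
        ∑ n ∈ Ioc 0 N, y ^ Ω n * (Real.log N - Real.log n) := by
      rw [← sum_add_distrib, sum_mul]
      exact sum_congr rfl fun n _ => by ring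
    linarith
  rw [Real.rpow_sub_one hlN.ne', mul_div_assoc', le_div_iff₀ hlN]
  calc _ ≤ _ := h3
    _ ≤ (A + 1) * N * (B * Real.log N ^ y) := by
      gcongr
      exact hB N hN
    _ = _ := by ring

/-! ### The multiplication table theorem. -/

theorem le_multiplication_table_exponent :
    (0.086 : ℝ) ≤ 1 - (1 + Real.log (Real.log 2)) / Real.log 2 := by
  have hl := Real.log_two_gt_d9
  have hu := Real.log_two_lt_d9
  have hl0 : 0 < Real.log 2 := by linarith
  have he : Real.exp 0.36647 ≤ 1.442694 := by
    refine (Real.exp_bound' (n := 8) (by norm_num) (by norm_num) (by norm_num)).trans ?_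
    simp only [sum_range_succ, sum_range_zero, Nat.factorial]
    norm_num
  have hll : Real.log (Real.log 2) ≤ -0.36647 := by
    rw [Real.log_le_iff_le_exp hl0, Real.exp_neg, le_inv_comm₀ hl0 (Real.exp_pos _)]
    refine he.trans ?_
    rw [le_inv_comm₀ (by norm_num) hl0]
    refine hu.le.trans ?_
    norm_num
  rw [le_sub_comm, div_le_iff₀ hl0]
  linarith

/-- Entries with `Ω > K` are counted as integers up to `N ^ 2`, the others as pairs `(a, b)`; each
count is bounded by an exponential moment, with `y ≥ 1` for the upper tail and `z ≤ 1` for the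
lower. -/
theorem card_table_le (N : ℕ) (K : ℝ) {y z : ℝ} (hy : 1 ≤ y) (hz0 : 0 < z) (hz : z ≤ 1) :
    ((((Ioc 0 N ×ˢ Ioc 0 N).image fun p => p.1 * p.2).card : ℕ) : ℝ) ≤
      y ^ (-K) * ∑ n ∈ Ioc 0 (N * N), y ^ Ω n + z ^ (-K) * (∑ n ∈ Ioc 0 N, z ^ Ω n) ^ 2 := by
  classical
  have hy0 : 0 < y := by linarith
  set U := (Ioc 0 (N * N)).filter fun n => K < (Ω n : ℝ)
  set V := (Ioc 0 N ×ˢ Ioc 0 N).filter fun p => ((Ω p.1 + Ω p.2 : ℕ) : ℝ) ≤ K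
  have hsub : ((Ioc 0 N ×ˢ Ioc 0 N).image fun p => p.1 * p.2) ⊆
      U ∪ V.image fun p => p.1 * p.2 := by
    intro n hn
    obtain ⟨⟨a, b⟩, hab, rfl⟩ := mem_image.1 hn
    have hab' := hab
    simp only [mem_product, mem_Ioc] at hab'
    obtain ⟨⟨ha, haN⟩, hb, hbN⟩ := hab'
    rw [mem_union]
    rcases lt_or_ge K ((Ω a + Ω b : ℕ) : ℝ) with h | h
    · refine Or.inl (mem_filter.2 ⟨mem_Ioc.2 ⟨Nat.mul_pos ha hb, Nat.mul_le_mul haN hbN⟩, ?_⟩)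
      rwa [cardFactors_mul ha.ne' hb.ne']
    · exact Or.inr (mem_image.2 ⟨(a, b), mem_filter.2 ⟨hab, h⟩, rfl⟩)
  have hU : (U.card : ℝ) ≤ y ^ (-K) * ∑ n ∈ Ioc 0 (N * N), y ^ Ω n := by
    rw [card_eq_sum_ones, Nat.cast_sum, mul_sum]
    refine le_trans (sum_le_sum fun n hn => ?_)
      (sum_le_sum_of_subset_of_nonneg (filter_subset _ _) fun n _ _ => by positivity)
    rw [← Real.rpow_natCast, ← Real.rpow_add hy0, Nat.cast_one]
    exact Real.one_le_rpow hy (by linarith [(mem_filter.1 hn).2])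
  have hV : (V.card : ℝ) ≤ z ^ (-K) * (∑ n ∈ Ioc 0 N, z ^ Ω n) ^ 2 := by
    rw [card_eq_sum_ones, Nat.cast_sum, sq, sum_mul_sum, ← sum_product', mul_sum]
    refine le_trans (sum_le_sum fun p hp => ?_)
      (sum_le_sum_of_subset_of_nonneg (filter_subset _ _) fun n _ _ => by positivity)
    rw [← pow_add, ← Real.rpow_natCast, ← Real.rpow_add hz0, Nat.cast_one]
    exact Real.one_le_rpow_of_pos_of_le_one_of_nonpos hz0 hz (by linarith [(mem_filter.1 hp).2])
  have hc := (card_le_card hsub).trans ((card_union_le _ _).trans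
    (Nat.add_le_add_left card_image_le _))
  calc _ ≤ ((U.card + V.card : ℕ) : ℝ) := by exact_mod_cast hc
    _ ≤ _ := by push_cast; linarith

/-- Erdős's multiplication table theorem, as an upper bound with a numerical exponent. -/
theorem exists_card_table_le :
    ∃ A : ℝ, 0 < A ∧ ∀ N : ℕ, 2 ≤ N →
      ((((Ioc 0 N ×ˢ Ioc 0 N).image fun p => p.1 * p.2).card : ℕ) : ℝ) ≤
        A * N ^ 2 * Real.log N ^ (-0.086 : ℝ) := by
  set L := Real.log 2 with hL
  have hl := Real.log_two_gt_d9
  have hu := Real.log_two_lt_d9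
  rw [← hL] at hl hu
  have hL0 : 0 < L := by linarith
  -- For the threshold `K = log log N / log 2`, these `y` and `z` minimise the exponents `-log y / L
  -- + (y - 1)` and `-log z / L + 2 * (z - 1)` of `log N`; both minima equal `-δ`.
  set y := 1 / L with hy
  set z := 1 / (2 * L) with hz
  set δ := 1 - (1 + Real.log L) / L with hδ
  have hδ' : 0.086 ≤ δ := le_multiplication_table_exponent
  have hy1 : 1 ≤ y := by rw [hy, le_div_iff₀ hL0]; linarith
  have hy2 : y < 2 := by rw [hy, div_lt_iff₀ hL0]; linarith
  have hz0 : 0 < z := by positivity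
  have hz1 : z ≤ 1 := by rw [hz, div_le_one (by positivity)]; linarith
  obtain ⟨A₁, hA₁0, hA₁⟩ := exists_sum_pow_cardFactors_le (by linarith : 0 < y) hy2
  obtain ⟨A₂, hA₂0, hA₂⟩ := exists_sum_pow_cardFactors_le hz0 (by linarith)
  refine ⟨(A₁ * 2 ^ (y - 1) + A₂ ^ 2) * L ^ (-(δ - 0.086)), by positivity, fun N hN => ?_⟩
  have hN2 : (2 : ℝ) ≤ N := by exact_mod_cast hN
  have hlNL : L ≤ Real.log N := Real.log_le_log two_pos hN2
  set l := Real.log N with hldef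
  have hl0 : 0 < l := by linarith
  have hlogy : Real.log y = -Real.log L := by rw [hy, one_div, Real.log_inv]
  have hlogz : Real.log z = -Real.log L - L := by
    rw [hz, one_div, Real.log_inv, Real.log_mul two_ne_zero hL0.ne']
    ring
  have hpow {w : ℝ} (hw : 0 < w) : w ^ (-(Real.log l / L)) = l ^ (-(Real.log w / L)) := by
    rw [Real.rpow_def_of_pos hw, Real.rpow_def_of_pos hl0]
    congr 1
    ring
  have h1 : y ^ (-(Real.log l / L)) * ∑ n ∈ Ioc 0 (N * N), y ^ Ω n ≤
      A₁ * 2 ^ (y - 1) * N ^ 2 * l ^ (-δ) := by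
    have hlog : Real.log ((N * N : ℕ) : ℝ) = 2 * l := by
      rw [Nat.cast_mul, Real.log_mul (by positivity) (by positivity)]
      ring
    have h := hA₁ (N * N) (by nlinarith)
    rw [hlog, Real.mul_rpow two_pos.le hl0.le] at h
    have hexp : -δ = -(Real.log y / L) + (y - 1) := by
      rw [hlogy, hδ, hy]
      ring
    rw [hpow (by linarith : 0 < y), hexp, Real.rpow_add hl0]
    calc _ ≤ l ^ (-(Real.log y / L)) *
          (A₁ * ((N * N : ℕ) : ℝ) * (2 ^ (y - 1) * l ^ (y - 1))) := by gcongr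
      _ = _ := by push_cast; ring
  have h2 : z ^ (-(Real.log l / L)) * (∑ n ∈ Ioc 0 N, z ^ Ω n) ^ 2 ≤
      A₂ ^ 2 * N ^ 2 * l ^ (-δ) := by
    have h := hA₂ N hN
    have hexp : -δ = -(Real.log z / L) + ((z - 1) + (z - 1)) := by
      rw [hlogz, hδ, hz]
      field_simp
      ring
    rw [hpow hz0, hexp, Real.rpow_add hl0, Real.rpow_add hl0 (z - 1)]
    calc _ ≤ l ^ (-(Real.log z / L)) * (A₂ * N * l ^ (z - 1)) ^ 2 := by
          have : 0 ≤ ∑ n ∈ Ioc 0 N, z ^ Ω n := sum_nonneg fun n _ => by positivity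
          gcongr
      _ = _ := by ring
  have h3 : l ^ (-δ) ≤ L ^ (-(δ - 0.086)) * l ^ (-0.086 : ℝ) := by
    have : -δ = -(δ - 0.086) + (-0.086) := by ring
    rw [this, Real.rpow_add hl0]
    gcongr ?_ * _
    exact Real.rpow_le_rpow_of_nonpos hL0 hlNL (by linarith)
  calc _ ≤ _ := card_table_le N (Real.log l / L) hy1 hz0 hz1
    _ ≤ A₁ * 2 ^ (y - 1) * N ^ 2 * l ^ (-δ) + A₂ ^ 2 * N ^ 2 * l ^ (-δ) := add_le_add h1 h2
    _ = (A₁ * 2 ^ (y - 1) + A₂ ^ 2) * N ^ 2 * l ^ (-δ) := by ring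
    _ ≤ (A₁ * 2 ^ (y - 1) + A₂ ^ 2) * N ^ 2 * (L ^ (-(δ - 0.086)) * l ^ (-0.086 : ℝ)) := by
      gcongr
    _ = _ := by ring

/-! ### Covering argument and the lower bound. -/

namespace AdmissibleRadius

theorem half_le {c : ℝ} {F : ℝ → ℝ} (hF : AdmissibleRadius c F) {m : ℕ} (hm : 1 ≤ m) :
    1 / 2 ≤ F (m + 1 / 2) := by
  have hm' : (1 : ℝ) ≤ m := by exact_mod_cast hm
  obtain ⟨n, -, -, -, -, -, h1, h2⟩ := hF (m + 1 / 2) (by linarith)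
  rcases le_or_gt n (m : ℤ) with h | h
  · have : (n : ℝ) ≤ m := by exact_mod_cast h
    linarith
  · have : (m : ℝ) + 1 ≤ n := by exact_mod_cast h
    linarith

theorem le_mul_card {c : ℝ} {F : ℝ → ℝ} (hF : AdmissibleRadius c F) (hc : 0 ≤ c) {x H : ℝ}
    (hx : 1 ≤ x) {N : ℕ} (hN : c * Real.sqrt (2 * x) ≤ N)
    (hH : ∀ y ∈ Set.Icc x (2 * x), F y < H) :
    x ≤ 2 * H * (((Ioc 0 N ×ˢ Ioc 0 N).image fun p => p.1 * p.2).card + 1) := by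
  classical
  set T := (Ioc 0 N ×ˢ Ioc 0 N).image fun p => p.1 * p.2
  -- The table has positive factors only, so products with a zero factor are accounted for by
  -- inserting `0`.
  have hcov : Set.Icc x (2 * x) ⊆ ⋃ n ∈ insert 0 T, Set.Icc ((n : ℝ) - H) (n + H) := by
    intro y hy
    obtain ⟨n, a, b, hn, ⟨ha0, ha⟩, ⟨hb0, hb⟩, h1, h2⟩ := hF y (hx.trans hy.1)
    have hsq : c * Real.sqrt y ≤ N :=
      (mul_le_mul_of_nonneg_left (Real.sqrt_le_sqrt hy.2) hc).trans hN
    have ha0' : 0 ≤ a := by exact_mod_cast ha0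
    have hb0' : 0 ≤ b := by exact_mod_cast hb0
    lift a to ℕ using ha0'
    lift b to ℕ using hb0'
    have haN : a ≤ N := by exact_mod_cast ha.trans hsq
    have hbN : b ≤ N := by exact_mod_cast hb.trans hsq
    have hmem : a * b ∈ insert 0 T := by
      rcases Nat.eq_zero_or_pos a with rfl | ha1
      · simp
      rcases Nat.eq_zero_or_pos b with rfl | hb1
      · simp
      exact mem_insert_of_mem (mem_image.2 ⟨(a, b), by simp [*], rfl⟩)
    refine Set.mem_biUnion hmem ?_
    have hnab : (n : ℝ) = ((a * b : ℕ) : ℝ) := by rw [hn]; push_cast; rfl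
    rw [← hnab]
    have := hH y hy
    constructor <;> linarith
  have hH0 : 0 ≤ H := by
    obtain ⟨n, -, -, -, -, -, h1, h2⟩ := hF x hx
    have := hH x ⟨le_rfl, by linarith⟩
    linarith
  have hvol : ENNReal.ofReal x ≤ ENNReal.ofReal (2 * H * (T.card + 1)) := by
    calc ENNReal.ofReal x = MeasureTheory.volume (Set.Icc x (2 * x)) := by
          rw [Real.volume_Icc]
          congr 1
          ring
      _ ≤ ∑ n ∈ insert 0 T, MeasureTheory.volume (Set.Icc ((n : ℝ) - H) (n + H)) :=
          (MeasureTheory.measure_mono hcov).trans (MeasureTheory.measure_biUnion_finset_le _ _)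
      _ = ∑ n ∈ insert 0 T, ENNReal.ofReal (2 * H) := sum_congr rfl fun n _ => by
          rw [Real.volume_Icc]
          congr 1
          ring
      _ = ENNReal.ofReal (2 * H * (insert 0 T).card) := by
          rw [sum_const, nsmul_eq_mul, mul_comm (2 * H), ENNReal.ofReal_mul (Nat.cast_nonneg _),
            ENNReal.ofReal_natCast]
      _ ≤ _ := by
          gcongr
          exact_mod_cast card_insert_le 0 T
  exact (ENNReal.ofReal_le_ofReal_iff (by positivity)).1 hvol

end AdmissibleRadius

theorem half_rpow_ge : (1 / 2 : ℝ) ≤ (1 / 2) ^ (0.086 : ℝ) := by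
  simpa using Real.rpow_le_rpow_of_exponent_ge (x := (1 / 2 : ℝ)) (by norm_num) (by norm_num)
    (show (0.086 : ℝ) ≤ 1 by norm_num)

theorem half_mul_log_rpow_le {x w : ℝ} (hx : 1 ≤ x) (hw : Real.log x / 2 ≤ w) :
    1 / 2 * Real.log x ^ (0.086 : ℝ) ≤ w ^ (0.086 : ℝ) := by
  have hl : 0 ≤ Real.log x := Real.log_nonneg hx
  calc 1 / 2 * Real.log x ^ (0.086 : ℝ) ≤ (1 / 2) ^ (0.086 : ℝ) * Real.log x ^ (0.086 : ℝ) :=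
        mul_le_mul_of_nonneg_right half_rpow_ge (by positivity)
    _ = (1 / 2 * Real.log x) ^ (0.086 : ℝ) := (Real.mul_rpow (by norm_num) hl).symm
    _ ≤ _ := Real.rpow_le_rpow (by positivity) (by linarith) (by norm_num)

theorem exists_lower_bound_admissibleRadius {c : ℝ} (hc : 0 < c) :
    ∃ C : ℝ, 0 < C ∧ ∀ F : ℝ → ℝ, AdmissibleRadius c F →
      ∀ x : ℝ, 2 ≤ x → ∃ y ∈ Set.Icc x (2 * x), C * (Real.log x) ^ (0.086 : ℝ) ≤ F y := by
  obtain ⟨A, hA0, hA⟩ := exists_card_table_le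
  refine ⟨1 / (32 * A * (c + 2) ^ 2), by positivity, fun F hF x hx => ?_⟩
  by_contra! hcon
  have hx0 : 0 < x := by linarith
  have hlx : 0 < Real.log x := Real.log_pos (by linarith)
  set H := 1 / (32 * A * (c + 2) ^ 2) * (Real.log x) ^ (0.086 : ℝ) with hH
  set r := Real.sqrt (2 * x) with hr
  have hr2 : r ^ 2 = 2 * x := Real.sq_sqrt (by positivity)
  have hr0 : 2 ≤ r := Real.le_sqrt_of_sq_le (by linarith)
  -- Using `c + 1` instead of `c` gives `N ≥ √(2x)`, hence `log N ≥ (log x) / 2`, even for small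
  -- `c`.
  set N := ⌈(c + 1) * r⌉₊ with hNdef
  have hN1 : (c + 1) * r ≤ N := Nat.le_ceil _
  have hN2 : (N : ℝ) ≤ (c + 2) * r := by
    have := Nat.ceil_lt_add_one (a := (c + 1) * r) (by positivity)
    rw [← hNdef] at this
    linarith
  have hNr : r ≤ N := by nlinarith
  have hN : 2 ≤ N := by exact_mod_cast hr0.trans hNr
  have hmain := hF.le_mul_card hc.le (by linarith) (N := N) (by rw [← hr]; linarith) hcon
  set T := ((Ioc 0 N ×ˢ Ioc 0 N).image fun p => p.1 * p.2).card with hT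
  have hT1 : (1 : ℝ) ≤ T := by
    have : 0 < T := card_pos.2 ⟨1, mem_image.2 ⟨(1, 1), by simp; omega, rfl⟩⟩
    exact_mod_cast this
  have hlogN : Real.log x / 2 ≤ Real.log N := by
    have h1 : Real.log x ≤ Real.log (r ^ 2) := Real.log_le_log hx0 (by linarith)
    rw [Real.log_pow] at h1
    have h2 : Real.log r ≤ Real.log N := Real.log_le_log (by linarith) hNr
    push_cast at h1
    linarith
  have hpow := half_mul_log_rpow_le (by linarith : 1 ≤ x) hlogN
  have hTle := hA N hN
  rw [← hT, Real.rpow_neg (by linarith), ← div_eq_mul_inv, le_div_iff₀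
    (Real.rpow_pos_of_pos (by linarith) _)] at hTle
  have hlp : 0 < Real.log x ^ (0.086 : ℝ) := Real.rpow_pos_of_pos hlx _
  set P := Real.log x ^ (0.086 : ℝ)
  have h5 : (T : ℝ) * (1 / 2 * P) ≤ A * (2 * (c + 2) ^ 2 * x) := by
    calc (T : ℝ) * (1 / 2 * P) ≤ T * Real.log N ^ (0.086 : ℝ) := by gcongr
      _ ≤ A * N ^ 2 := hTle
      _ ≤ A * ((c + 2) * r) ^ 2 := by gcongr
      _ = _ := by rw [mul_pow, hr2]; ring
  -- The constant in `H` is chosen so that the right side is at most `x / 2`, a contradiction.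
  have h6 : x ≤ 4 * H * T := by
    have hH0 : 0 ≤ H := by positivity
    nlinarith
  have h7 : 4 * H * T = (T * (1 / 2 * P)) * (1 / (4 * A * (c + 2) ^ 2)) := by
    rw [hH]
    field_simp
    ring
  have h8 : (T * (1 / 2 * P)) * (1 / (4 * A * (c + 2) ^ 2)) ≤
      A * (2 * (c + 2) ^ 2 * x) * (1 / (4 * A * (c + 2) ^ 2)) := by gcongr
  have h9 : A * (2 * (c + 2) ^ 2 * x) * (1 / (4 * A * (c + 2) ^ 2)) = x / 2 := by
    field_simp
    ring
  linarith

theorem exists_lower_bound_admissibleRadius_and_monotoneOn {c : ℝ} (hc : 0 < c) :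
    ∃ C : ℝ, 0 < C ∧ ∀ F : ℝ → ℝ, AdmissibleRadius c F →
      (∀ x : ℝ, 2 ≤ x → ∃ y ∈ Set.Icc x (2 * x), C * (Real.log x) ^ (0.086 : ℝ) ≤ F y) ∧
      (MonotoneOn F (Set.Ici 1) → ∀ x : ℝ, 2 ≤ x → C * (Real.log x) ^ (0.086 : ℝ) ≤ F x) := by
  obtain ⟨C, hC0, hC⟩ := exists_lower_bound_admissibleRadius hc
  refine ⟨min (C / 2) (1 / 4), by positivity, fun F hF => ⟨fun x hx => ?_, fun hmono x hx => ?_⟩⟩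
  · obtain ⟨y, hy, h⟩ := hC F hF x hx
    have hlx : 0 ≤ Real.log x := Real.log_nonneg (by linarith)
    refine ⟨y, hy, le_trans ?_ h⟩
    gcongr
    exact (min_le_left _ _).trans (by linarith)
  have hlx : 0 ≤ Real.log x := Real.log_nonneg (by linarith)
  -- Monotonicity transfers the bound from `[x / 2, x]` to `x`, which requires `x / 2 ≥ 2`. For
  -- smaller `x` it suffices that `F (3 / 2) ≥ 1 / 2`, as `3 / 2` is that far from every integer.
  rcases lt_or_ge x 4 with h4 | h4
  · have h1 := hF.half_le (m := 1) le_rfl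
    have h2 : F ((1 : ℕ) + 1 / 2) ≤ F x :=
      hmono (by simp) (Set.mem_Ici.2 (by linarith)) (by push_cast; linarith)
    have h3 : Real.log x ≤ 2 := by
      have : Real.log x ≤ Real.log (2 ^ 2) := Real.log_le_log (by linarith) (by linarith)
      rw [Real.log_pow] at this
      have := Real.log_two_lt_d9
      push_cast at *
      linarith
    have h5 : Real.log x ^ (0.086 : ℝ) ≤ 2 := by
      refine (Real.rpow_le_rpow hlx h3 (by norm_num)).trans ?_
      simpa using Real.rpow_le_rpow_of_exponent_le (x := (2 : ℝ)) (by norm_num)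
        (show (0.086 : ℝ) ≤ 1 by norm_num)
    have : min (C / 2) (1 / 4) * Real.log x ^ (0.086 : ℝ) ≤ 1 / 4 * 2 := by
      gcongr
      exact min_le_right _ _
    linarith
  · obtain ⟨y, ⟨hy1, hy2⟩, h⟩ := hC F hF (x / 2) (by linarith)
    have h2 : F y ≤ F x :=
      hmono (Set.mem_Ici.2 (by linarith)) (Set.mem_Ici.2 (by linarith)) (by linarith)
    have h3 : Real.log x / 2 ≤ Real.log (x / 2) := by
      have : Real.log (2 ^ 2) ≤ Real.log x := Real.log_le_log (by norm_num) (by linarith)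
      rw [Real.log_pow] at this
      rw [Real.log_div (by linarith) two_ne_zero]
      push_cast at this
      linarith
    have h5 := half_mul_log_rpow_le (by linarith : 1 ≤ x) h3
    calc min (C / 2) (1 / 4) * Real.log x ^ (0.086 : ℝ)
        ≤ C / 2 * Real.log x ^ (0.086 : ℝ) := by
          gcongr
          exact min_le_left _ _
      _ = C * (1 / 2 * Real.log x ^ (0.086 : ℝ)) := by ring
      _ ≤ C * Real.log (x / 2) ^ (0.086 : ℝ) := by gcongr
      _ ≤ F x := h.trans h2

/-! ### The upper bound by differences of squares. -/

theorem exists_admissibleRadius_mul_rpow {c : ℝ} (hc : 1 < c) :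
    ∃ C : ℝ, 0 < C ∧ AdmissibleRadius c (fun x => C * x ^ (1 / 4 : ℝ)) := by
  have hc' : 0 < c - 1 := by linarith
  refine ⟨5 + (3 / (c - 1)) ^ 3, by positivity, fun x hx => ?_⟩
  have hx0 : 0 < x := by linarith
  set q := x ^ (1 / 4 : ℝ) with hq
  have hq0 : 0 < q := by positivity
  have hq1 : 1 ≤ q := Real.one_le_rpow hx (by norm_num)
  have hq4 : q ^ 4 = x := by
    rw [hq, ← Real.rpow_natCast, ← Real.rpow_mul hx0.le]
    norm_num
  have hsq : Real.sqrt x = q ^ 2 := by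
    rw [← hq4, show q ^ 4 = (q ^ 2) ^ 2 by ring, Real.sqrt_sq (by positivity)]
  rw [hsq]
  have hd3 : 0 < (3 / (c - 1)) ^ 3 := by positivity
  -- When `q` is large, `u + v ≤ q ^ 2 + 1 + 2 * q ≤ c * q ^ 2`. When it is small, the product `0`
  -- suffices, as `x = q ^ 3 * q`.
  rcases lt_or_ge q (3 / (c - 1)) with h | h
  · have h3 : x ≤ (5 + (3 / (c - 1)) ^ 3) * q := by
      have : q ^ 3 ≤ (3 / (c - 1)) ^ 3 := by gcongr
      calc x = q ^ 3 * q := by rw [← hq4]; ring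
        _ ≤ _ := by gcongr; linarith
    have hcq : 0 ≤ c * q ^ 2 := by positivity
    refine ⟨0, 0, 0, by simp, ⟨by simp, by simpa using hcq⟩, ⟨by simp, by simpa using hcq⟩, ?_, ?_⟩
    · push_cast; linarith
    · push_cast; linarith
  · rw [div_le_iff₀ hc'] at h
    set u := ⌈q ^ 2⌉₊ with hu
    have hu1 : q ^ 2 ≤ u := Nat.le_ceil _
    have hu2 : (u : ℝ) < q ^ 2 + 1 := Nat.ceil_lt_add_one (by positivity)
    have hux : x ≤ (u : ℝ) ^ 2 := by
      rw [← hq4, show q ^ 4 = (q ^ 2) ^ 2 by ring]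
      gcongr
    -- Exactly, `x = u ^ 2 - t ^ 2`; rounding `t` down to `v` costs `t ^ 2 - v ^ 2 ≤ 2 * t ≤ 4 * q`.
    set t := Real.sqrt ((u : ℝ) ^ 2 - x) with ht
    have ht0 : 0 ≤ t := Real.sqrt_nonneg _
    have ht2 : t ^ 2 = (u : ℝ) ^ 2 - x := Real.sq_sqrt (by linarith)
    have htq : t ≤ 2 * q := by
      refine abs_le_of_sq_le_sq' ?_ (by positivity) |>.2
      rw [ht2, ← hq4]
      nlinarith
    set v := ⌊t⌋₊ with hv
    have hv1 : (v : ℝ) ≤ t := Nat.floor_le ht0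
    have hv2 : t < v + 1 := Nat.lt_floor_add_one t
    have htu : t ≤ u := abs_le_of_sq_le_sq' (by rw [ht2]; linarith) (by positivity) |>.2
    have hv0 : (0 : ℝ) ≤ v := Nat.cast_nonneg v
    have hsum : (u : ℝ) + v ≤ c * q ^ 2 := by nlinarith
    refine ⟨((u : ℤ) - v) * (u + v), u - v, u + v, rfl, ⟨?_, ?_⟩, ⟨?_, ?_⟩, ?_, ?_⟩ <;> push_cast
    · linarith
    · linarith
    · linarith
    · linarith
    · nlinarith
    · nlinarith

/-! ### The least non-decreasing radius and the conclusion. -/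

theorem exists_isLeastMonotoneRadius {c : ℝ} (hc : 0 ≤ c) :
    ∃ F : ℝ → ℝ, IsLeastMonotoneRadius c F := by
  -- The distance `d x` to the nearest allowed product is attained because only finitely many pairs
  -- compete; `0 * 0` gives `d x ≤ x`, so the running supremum is finite.
  have hex : ∀ x : ℝ, ∃ d : ℝ,
      (∃ a b : ℤ, (a : ℝ) ∈ Set.Icc 0 (c * Real.sqrt x) ∧ (b : ℝ) ∈ Set.Icc 0 (c * Real.sqrt x) ∧
        |((a * b : ℤ) : ℝ) - x| = d) ∧
      ∀ a b : ℤ, (a : ℝ) ∈ Set.Icc 0 (c * Real.sqrt x) → (b : ℝ) ∈ Set.Icc 0 (c * Real.sqrt x) →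
        d ≤ |((a * b : ℤ) : ℝ) - x| := by
    intro x
    have hmem (a : ℤ) : (a : ℝ) ∈ Set.Icc 0 (c * Real.sqrt x) ↔
        a ∈ Finset.Icc 0 ⌊c * Real.sqrt x⌋ := by
      simp [Int.le_floor]
    have hne : (0 : ℤ) ∈ Finset.Icc 0 ⌊c * Real.sqrt x⌋ := by
      rw [← hmem]
      simpa using by positivity
    obtain ⟨p, hp, hmin⟩ := exists_min_image
      (Finset.Icc 0 ⌊c * Real.sqrt x⌋ ×ˢ Finset.Icc 0 ⌊c * Real.sqrt x⌋)
      (fun p : ℤ × ℤ => |((p.1 * p.2 : ℤ) : ℝ) - x|) ⟨(0, 0), mem_product.2 ⟨hne, hne⟩⟩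
    simp only [hmem]
    exact ⟨_, ⟨p.1, p.2, (mem_product.1 hp).1, (mem_product.1 hp).2, rfl⟩,
      fun a b ha hb => hmin (a, b) (mem_product.2 ⟨ha, hb⟩)⟩
  choose d hd hmin using hex
  have hdx : ∀ x, 0 ≤ x → d x ≤ x := fun x hx => by
    have h0 : ((0 : ℤ) : ℝ) ∈ Set.Icc 0 (c * Real.sqrt x) := by
      simpa using by positivity
    simpa [abs_of_nonneg hx] using hmin x 0 0 h0 h0
  have hbdd : ∀ x, BddAbove (d '' Set.Icc 1 x) := fun x => by
    refine ⟨x, ?_⟩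
    rintro _ ⟨y, hy, rfl⟩
    exact (hdx y (by linarith [hy.1])).trans hy.2
  refine ⟨fun x => sSup (d '' Set.Icc 1 x), fun x hx => ?_, fun x hx y hy hxy => ?_,
    fun G hG hmono x hx => ?_⟩
  · obtain ⟨a, b, ha, hb, hab⟩ := hd x
    have hle : d x ≤ sSup (d '' Set.Icc 1 x) := le_csSup (hbdd x) ⟨x, ⟨hx, le_rfl⟩, rfl⟩
    have := abs_le.1 (hab.le.trans hle)
    exact ⟨a * b, a, b, rfl, ha, hb, by linarith [this.1], by linarith [this.2]⟩
  · exact csSup_le_csSup (hbdd y) ⟨d x, x, ⟨hx, le_rfl⟩, rfl⟩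
      (Set.image_mono (Set.Icc_subset_Icc_right hxy))
  · refine csSup_le ⟨d x, x, ⟨hx, le_rfl⟩, rfl⟩ ?_
    rintro _ ⟨y, hy, rfl⟩
    obtain ⟨n, a, b, rfl, ha, hb, h1, h2⟩ := hG y hy.1
    calc d y ≤ |((a * b : ℤ) : ℝ) - y| := hmin y a b ha hb
      _ ≤ G y := abs_le.2 ⟨by linarith, by linarith⟩
      _ ≤ G x := hmono hy.1 hx hy.2

end

theorem mainTheorem6 :
    -- lower bound, for every admissible radius, with a constant depending only on `c`
    (∀ c : ℝ, 0 < c → ∃ C : ℝ, 0 < C ∧ ∀ F : ℝ → ℝ, AdmissibleRadius c F →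
      (∀ x : ℝ, 2 ≤ x → ∃ y ∈ Set.Icc x (2 * x), C * (Real.log x) ^ (0.086 : ℝ) ≤ F y) ∧
      (MonotoneOn F (Set.Ici 1) → ∀ x : ℝ, 2 ≤ x → C * (Real.log x) ^ (0.086 : ℝ) ≤ F x)) ∧
    -- upper bound: a constant multiple of `x ^ (1 / 4)` is admissible
    (∀ c : ℝ, 1 < c → ∃ C : ℝ, 0 < C ∧ AdmissibleRadius c (fun x => C * x ^ (1 / 4 : ℝ))) ∧
    -- the least non-decreasing admissible radius exists and satisfies both bounds
    (∀ c : ℝ, 1 < c → ∃ F : ℝ → ℝ, IsLeastMonotoneRadius c F ∧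
      ∃ C₁ C₂ : ℝ, 0 < C₁ ∧ 0 < C₂ ∧ ∀ x : ℝ, 2 ≤ x →
        C₁ * (Real.log x) ^ (0.086 : ℝ) ≤ F x ∧ F x ≤ C₂ * x ^ (1 / 4 : ℝ)) := by
  refine ⟨fun c hc => exists_lower_bound_admissibleRadius_and_monotoneOn hc,
    fun c hc => exists_admissibleRadius_mul_rpow hc, fun c hc => ?_⟩
  obtain ⟨F, hF⟩ := exists_isLeastMonotoneRadius (c := c) (by linarith)
  obtain ⟨C₁, hC₁, h₁⟩ := exists_lower_bound_admissibleRadius_and_monotoneOn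
    (c := c) (by linarith)
  obtain ⟨C₂, hC₂, h₂⟩ := exists_admissibleRadius_mul_rpow hc
  refine ⟨F, hF, C₁, C₂, hC₁, hC₂, fun x hx => ⟨(h₁ F hF.1).2 hF.2.1 x hx, ?_⟩⟩
  refine hF.2.2 _ h₂ (fun a ha b _ hab => ?_) x (by linarith)
  have ha' : (0 : ℝ) ≤ a := zero_le_one.trans ha
  dsimp only
  gcongr
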